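/- Let $\Omega\subset\mathbb C^n$ be a domain (a nonempty connected open set) and let $\psi:\Omega\to[-\infty,\infty)$ be plurisubharmonic and not identically $-\infty$; that is, $\psi$ is upper semicontinuous and $$\psi(a)\le\frac1{2\pi}\int_0^{2\pi}\psi(a+e^{i\theta}b)\,d\theta$$ for all $a,b\in\mathbb C^n$ such that $a+\zeta b\in\Omega$ for every $\zeta\in\mathbb C$ with $|\zeta|\le1$. Then $\psi$ is locally BMO on $\Omega$: for every open set $\Omega'\Subset\Omega$ (that is, $\overline{\Omega'}$ is compact and contained in $\Omega$), in particular for every domain $\Omega'\Subset\Omega$, we have $\psi\in\mathrm{BMO}(\Omega')$. This means that $\psi$ is finite almost everywhere on $\Omega'$, $\psi\in L^1_{\rm loc}(\Omega')$, and $$\|\psi\|_{\mathrm{BMO}(\Omega')}:=\sup_{B}\frac1{|B|}\int_B|\psi-\psi_B|<\infty,\qquad \psi_B:=\frac1{|B|}\int_B\psi,$$ where the supremum is taken over all Euclidean open balls $B\subset\Omega'$ and $|\cdot|$ denotes Lebesgue measure. -/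

import Mathlib

open MeasureTheory Set
open scoped ENNReal

noncomputable section

namespace PshBMO

/-- A domain: a nonempty connected open set. -/
def IsDomainSet {E : Type*} [TopologicalSpace E] (Ω : Set E) : Prop :=
  IsOpen Ω ∧ IsConnected Ω

/-- `U ⋐ Ω`: the closure of `U` is compact and contained in `Ω`. -/
def CompactlyContained {E : Type*} [TopologicalSpace E] (U Ω : Set E) : Prop :=
  IsCompact (closure U) ∧ closure U ⊆ Ω

/-- The mean `(2π)⁻¹ ∫₀^{2π} g(θ) dθ` of an extended-real function, as the mean of the positive
part minus the mean of the negative part. It has its usual meaning whenever one of the two is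
finite; for functions bounded above it takes values in `[-∞, ∞)`. -/
def angularMean (g : ℝ → EReal) : EReal :=
  ((⨍⁻ θ in Ioc 0 (2 * Real.pi), (g θ).toENNReal ∂volume : ℝ≥0∞) : EReal)
    - ((⨍⁻ θ in Ioc 0 (2 * Real.pi), (-g θ).toENNReal ∂volume : ℝ≥0∞) : EReal)

/-- `ψ : Ω → [-∞, ∞)` is plurisubharmonic: it is upper semicontinuous and satisfies the
sub-mean value inequality on the boundary of each closed disc `{a + ζ b : |ζ| ≤ 1}` of a complex
line that is contained in `Ω`. Values of `ψ` outside `Ω` are irrelevant, and the constant `-∞`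
is allowed here. -/
structure IsPlurisubharmonicOn {n : ℕ} (ψ : EuclideanSpace ℂ (Fin n) → EReal)
    (Ω : Set (EuclideanSpace ℂ (Fin n))) : Prop where
  lt_top : ∀ z ∈ Ω, ψ z < ⊤
  upperSemicontinuousOn : UpperSemicontinuousOn ψ Ω
  le_angularMean : ∀ a b : EuclideanSpace ℂ (Fin n),
    (∀ ζ : ℂ, ‖ζ‖ ≤ 1 → a + ζ • b ∈ Ω) →
      ψ a ≤ angularMean fun θ => ψ (a + Complex.exp (θ * Complex.I) • b)

/-- `‖f‖_{BMO(U)}`: the supremum of the mean oscillations `|B|⁻¹ ∫_B |f - f_B|` over the open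
balls `B ⊆ U`. If a locally integrable `f` fails to be integrable over some such ball, then the
outer integral, hence the supremum, is `∞`. -/
def bmoSeminorm {E : Type*} [PseudoMetricSpace E] [MeasureSpace E]
    (f : E → ℝ) (U : Set E) : ℝ≥0∞ :=
  ⨆ (a : E) (r : ℝ) (_ : 0 < r ∧ Metric.ball a r ⊆ U),
    ⨍⁻ x in Metric.ball a r, ‖f x - ⨍ y in Metric.ball a r, f y ∂volume‖ₑ ∂volume

/-- An extended-real function belongs to `BMO(U)`: it is finite almost everywhere on `U`, lies in
`L¹_loc(U)`, and has finite BMO seminorm on `U`. -/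
structure MemBMO {E : Type*} [PseudoMetricSpace E] [MeasureSpace E]
    (f : E → EReal) (U : Set E) : Prop where
  ae_finite : ∀ᵐ x ∂(volume.restrict U), f x ≠ ⊥ ∧ f x ≠ ⊤
  locallyIntegrableOn : LocallyIntegrableOn (fun x => (f x).toReal) U volume
  seminorm_lt_top : bmoSeminorm (fun x => (f x).toReal) U < ⊤

/-- `f` is locally BMO on `Ω`: it lies in `BMO(U)` for every open `U ⋐ Ω`. -/
def MemBMOLoc {E : Type*} [PseudoMetricSpace E] [MeasureSpace E]
    (f : E → EReal) (Ω : Set E) : Prop :=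
  ∀ U : Set E, IsOpen U → CompactlyContained U Ω → MemBMO f U

end PshBMO

end

noncomputable section

namespace PshBMO

/-! On a line through the centre `a`, `ψ` obeys the maximum principle against `α + β log |ζ|`, which
gives Hadamard's three circles inequality (`le_three_spheres`). Suppose `ψ ≤ M` on the closed ball
of radius `R` about `a`, and `ψ p ≥ l` at some `p` within `R / 2` of `a`. The logarithmic growth of
`ψ` from radius `r` to `R` is then at most `(M - l) / log 2`, whatever `r` is, so the maximum `m`
over the `r`-ball and the supremum over the `4r`-ball differ by at most `2 (M - l)`
(`exists_le_add_of_closedBall`).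

Let `m` be attained at `x`, and put `N = m + 2 (M - l)`. The sub-mean value inequality for `N - ψ ≥
0` on the ball of radius `2r` about `x`, which contains the `r`-ball about `a`, bounds the mean of
`|ψ - N|` by a dimensional constant times `M - l`. Compactness makes `M`, `l` and `R` uniform in
`a`. Balls of radius at least `R / 4` have volume bounded below, so local integrability suffices for
them. Integrability itself comes from the sub-mean value inequality and connectedness of `Ω`. -/

/-! ### Angular means of extended-real functions -/

theorem angularMean_mono {g h : ℝ → EReal} (hgh : ∀ θ, g θ ≤ h θ) :
    angularMean g ≤ angularMean h := by
  unfold angularMean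
  refine EReal.sub_le_sub ?_ ?_
  · exact EReal.coe_ennreal_le_coe_ennreal_iff.2
      (lintegral_mono fun θ => EReal.toENNReal_le_toENNReal (hgh θ))
  · exact EReal.coe_ennreal_le_coe_ennreal_iff.2
      (lintegral_mono fun θ => EReal.toENNReal_le_toENNReal (EReal.neg_le_neg_iff.2 (hgh θ)))

theorem angularMean_coe {k : ℝ → ℝ} (hk : Continuous k) :
    angularMean (fun θ => (k θ : EReal)) =
      (((2 * Real.pi)⁻¹ * ∫ θ in (0 : ℝ)..2 * Real.pi, k θ : ℝ) : EReal) := by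
  have hint : IntegrableOn k (Ioc 0 (2 * Real.pi)) := hk.integrableOn_Ioc
  have hpi : 0 < 2 * Real.pi := by positivity
  have h1 : ∫⁻ θ in Ioc 0 (2 * Real.pi), ENNReal.ofReal (k θ) ≠ ∞ := hint.lintegral_lt_top.ne
  have h2 : ∫⁻ θ in Ioc 0 (2 * Real.pi), ENNReal.ofReal (-k θ) ≠ ∞ := hint.neg.lintegral_lt_top.ne
  have key := integral_eq_lintegral_pos_part_sub_lintegral_neg_part hint
  have hc : ∀ x : ℝ≥0∞, x ≠ ∞ → ((x / ENNReal.ofReal (2 * Real.pi) : ℝ≥0∞) : EReal) =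
      ((2 * Real.pi)⁻¹ * x.toReal : ℝ) := by
    intro x hx
    have hx' : x / ENNReal.ofReal (2 * Real.pi) ≠ ∞ :=
      ENNReal.div_ne_top hx (by simpa using Real.pi_pos)
    rw [← EReal.coe_ennreal_toReal hx', ENNReal.toReal_div,
      ENNReal.toReal_ofReal hpi.le, div_eq_inv_mul]
  simp only [angularMean, ← EReal.coe_neg, EReal.real_coe_toENNReal, setLAverage_eq,
    Real.volume_Ioc, sub_zero]
  rw [hc _ h1, hc _ h2, ← EReal.coe_sub, intervalIntegral.integral_of_le hpi.le, key, mul_sub]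

variable {n : ℕ} {ψ : EuclideanSpace ℂ (Fin n) → EReal} {Ω : Set (EuclideanSpace ℂ (Fin n))}

/-! ### Maximum principle on annuli in complex lines -/

/-- A continuous majorant on a circle bounds a plurisubharmonic function at the centre by its
mean. -/
theorem IsPlurisubharmonicOn.le_circleAverage (hψ : IsPlurisubharmonicOn ψ Ω)
    {a b : EuclideanSpace ℂ (Fin n)} {c : ℂ} {ρ : ℝ} (hρ : 0 ≤ ρ)
    (hΩ : ∀ ζ ∈ Metric.closedBall c ρ, a + ζ • b ∈ Ω) {k : ℂ → ℝ}
    (hk : ContinuousOn k (Metric.sphere c ρ))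
    (hle : ∀ ζ ∈ Metric.sphere c ρ, ψ (a + ζ • b) ≤ k ζ) :
    ψ (a + c • b) ≤ ((Real.circleAverage k c ρ : ℝ) : EReal) := by
  have hmean := hψ.le_angularMean (a + c • b) ((ρ : ℂ) • b) (fun ζ hζ => by
    have : a + c • b + ζ • (ρ : ℂ) • b = a + (c + ζ * ρ) • b := by module
    rw [this]
    refine hΩ _ ?_
    rw [mem_closedBall_iff_norm, add_sub_cancel_left, norm_mul, Complex.norm_real,
      Real.norm_of_nonneg hρ]
    exact mul_le_of_le_one_left hρ hζ)
  have hcm : ∀ θ, circleMap c ρ θ ∈ Metric.sphere c ρ := fun θ => circleMap_mem_sphere c hρ θ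
  have hcont : Continuous fun θ => k (circleMap c ρ θ) :=
    hk.comp_continuous (continuous_circleMap c ρ) hcm
  refine hmean.trans ((angularMean_mono fun θ => ?_).trans (angularMean_coe hcont).le)
  have : a + c • b + Complex.exp (θ * Complex.I) • (ρ : ℂ) • b = a + circleMap c ρ θ • b := by
    rw [circleMap]; module
  rw [this]
  exact hle _ (hcm θ)

/-- The cross terms integrate to zero. The excess `ρ ^ 2` over the value at the centre makes the
quadratic perturbation strictly subharmonic. -/
theorem circleAverage_normSq (c : ℂ) (ρ : ℝ) :
    Real.circleAverage (fun ζ => ‖ζ‖ ^ 2) c ρ = ‖c‖ ^ 2 + ρ ^ 2 := by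
  have hsq : ∀ θ : ℝ, ‖circleMap c ρ θ‖ ^ 2 =
      ‖c‖ ^ 2 + ρ ^ 2 + (2 * ρ * c.re) * Real.cos θ + (2 * ρ * c.im) * Real.sin θ := by
    intro θ
    rw [Complex.sq_norm, Complex.sq_norm, Complex.normSq_apply, Complex.normSq_apply]
    simp [circleMap, Complex.exp_ofReal_mul_I_re, Complex.exp_ofReal_mul_I_im]
    linear_combination ρ ^ 2 * Real.sin_sq_add_cos_sq θ
  have hpi := Real.pi_pos
  simp only [Real.circleAverage, hsq]
  rw [intervalIntegral.integral_add (by apply Continuous.intervalIntegrable; fun_prop)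
      (by apply Continuous.intervalIntegrable; fun_prop),
    intervalIntegral.integral_add (by apply Continuous.intervalIntegrable; fun_prop)
      (by apply Continuous.intervalIntegrable; fun_prop)]
  simp
  field_simp

theorem circleAverage_log_norm {c : ℂ} {ρ : ℝ} (hρ : 0 ≤ ρ) (h : ρ < ‖c‖) :
    Real.circleAverage (fun ζ => Real.log ‖ζ‖) c ρ = Real.log ‖c‖ := by
  refine InnerProductSpace.HarmonicOnNhd.circleAverage_eq (fun x hx => ?_)
  refine AnalyticAt.harmonicAt_log_norm (f := fun z => z) (by fun_prop) ?_
  rintro rfl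
  rw [abs_of_nonneg hρ, mem_closedBall_iff_norm, zero_sub, norm_neg] at hx
  linarith

/-- On a complex line, a plurisubharmonic function that is dominated by `α + β log |ζ|` on the
boundary of an annulus is dominated by it inside. -/
theorem IsPlurisubharmonicOn.le_log_of_annulus (hψ : IsPlurisubharmonicOn ψ Ω)
    {a b : EuclideanSpace ℂ (Fin n)} {r R : ℝ} (hr : 0 < r)
    (hΩ : ∀ ζ : ℂ, ‖ζ‖ ≤ R → a + ζ • b ∈ Ω) {α β : ℝ}
    (hbd : ∀ ζ : ℂ, ‖ζ‖ = r ∨ ‖ζ‖ = R → ψ (a + ζ • b) ≤ (α + β * Real.log ‖ζ‖ : ℝ))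
    {ζ : ℂ} (h1 : r ≤ ‖ζ‖) (h2 : ‖ζ‖ ≤ R) :
    ψ (a + ζ • b) ≤ (α + β * Real.log ‖ζ‖ : ℝ) := by
  set A : Set ℂ := {z | r ≤ ‖z‖ ∧ ‖z‖ ≤ R} with hA
  have hAc : IsCompact A := by
    refine (isCompact_closedBall (0 : ℂ) R).of_isClosed_subset ?_ ?_
    · exact (isClosed_le continuous_const continuous_norm).inter
        (isClosed_le continuous_norm continuous_const)
    · intro z hz
      simpa using hz.2
  have hlog : ContinuousOn (fun z : ℂ => Real.log ‖z‖) {z | z ≠ 0} := fun z hz =>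
    (continuous_norm.continuousAt.log (norm_ne_zero_iff.2 hz)).continuousWithinAt
  have hA0 : ∀ z ∈ A, z ≠ 0 := fun z hz => norm_pos_iff.1 (hr.trans_le hz.1)
  -- it suffices to have the bound up to a small quadratic error
  suffices H : ∀ ε : ℝ, 0 < ε →
      ψ (a + ζ • b) ≤ ((α + β * Real.log ‖ζ‖) + ε * R ^ 2 : ℝ) by
    have ht : Filter.Tendsto (fun ε : ℝ => (((α + β * Real.log ‖ζ‖) + ε * R ^ 2 : ℝ) : EReal))
        (nhdsWithin 0 (Ioi 0)) (nhds ((α + β * Real.log ‖ζ‖ : ℝ) : EReal)) := by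
      refine (continuous_coe_real_ereal.tendsto _).comp ?_
      have : Continuous fun ε : ℝ => (α + β * Real.log ‖ζ‖) + ε * R ^ 2 := by fun_prop
      have := (this.tendsto 0).mono_left (nhdsWithin_le_nhds (s := Ioi 0))
      simpa using this
    exact ge_of_tendsto ht (by filter_upwards [self_mem_nhdsWithin] with ε hε using H ε hε)
  intro ε hε
  set h : ℂ → ℝ := fun z => ε * ‖z‖ ^ 2 - (α + β * Real.log ‖z‖) with hh
  have hcont : ContinuousOn h {z | z ≠ 0} := by
    have := hlog
    fun_prop
  have husc : UpperSemicontinuousOn (fun z => ψ (a + z • b) + (h z : EReal)) A := by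
    refine UpperSemicontinuousOn.add' ?_ ?_ ?_
    · exact hψ.upperSemicontinuousOn.comp (by fun_prop) fun z hz => hΩ z hz.2
    · exact (continuous_coe_real_ereal.comp_continuousOn
        (hcont.mono hA0)).upperSemicontinuousOn
    · intro z _
      exact EReal.continuousAt_add (by simp) (by simp)
  obtain ⟨ζ₀, hζ₀, hmax⟩ := husc.exists_isMaxOn (show A.Nonempty from ⟨ζ, h1, h2⟩) hAc
  have hmax' : ∀ z ∈ A, ψ (a + z • b) + (h z : EReal) ≤ ψ (a + ζ₀ • b) + (h ζ₀ : EReal) :=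
    fun z hz => hmax hz
  have hle : ∀ {x m : EReal} {t : ℝ}, x + (t : EReal) ≤ m → x ≤ m - (t : EReal) := by
    intro x m t hx
    rwa [EReal.le_sub_iff_add_le (by simp) (by simp)]
  have hfin : ψ (a + ζ₀ • b) + (h ζ₀ : EReal) ≤ ((ε * R ^ 2 : ℝ) : EReal) := by
    by_cases hbdry : ‖ζ₀‖ = r ∨ ‖ζ₀‖ = R
    · calc ψ (a + ζ₀ • b) + (h ζ₀ : EReal)
          ≤ ((α + β * Real.log ‖ζ₀‖ : ℝ) : EReal) + (h ζ₀ : EReal) := by gcongr; exact hbd _ hbdry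
        _ = ((ε * ‖ζ₀‖ ^ 2 : ℝ) : EReal) := by
          rw [← EReal.coe_add, hh]; congr 1; ring
        _ ≤ _ := by
          have := hζ₀.2
          gcongr
    push Not at hbdry
    rcases eq_or_ne (ψ (a + ζ₀ • b)) ⊥ with hbot | hbot
    · simp [hbot]
    -- At an interior maximum with finite value, compare with the mean over a small circle: the
    -- logarithm is harmonic there, while the quadratic term gains `ε * ρ ^ 2 > 0`, a contradiction.
    exfalso
    have htop := (hψ.lt_top _ (hΩ ζ₀ hζ₀.2)).ne
    obtain ⟨c, hc⟩ : ∃ c : ℝ, ψ (a + ζ₀ • b) = c := ⟨_, (EReal.coe_toReal htop hbot).symm⟩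
    have hlt1 : r < ‖ζ₀‖ := lt_of_le_of_ne hζ₀.1 (Ne.symm hbdry.1)
    have hlt2 : ‖ζ₀‖ < R := lt_of_le_of_ne hζ₀.2 hbdry.2
    obtain ⟨ρ, hρ, hρ1, hρ2⟩ : ∃ ρ : ℝ, 0 < ρ ∧ ρ < ‖ζ₀‖ - r ∧ ρ < R - ‖ζ₀‖ := by
      obtain ⟨ρ, h1, h2⟩ := exists_between (lt_min (sub_pos.2 hlt1) (sub_pos.2 hlt2))
      exact ⟨ρ, h1, h2.trans_le (min_le_left _ _), h2.trans_le (min_le_right _ _)⟩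
    have hball : Metric.closedBall ζ₀ ρ ⊆ A := by
      intro z hz
      rw [mem_closedBall_iff_norm] at hz
      have e1 := norm_sub_norm_le ζ₀ z
      have e2 := norm_sub_norm_le z ζ₀
      rw [norm_sub_rev] at e1
      exact ⟨by linarith, by linarith⟩
    have hsph : Metric.sphere ζ₀ ρ ⊆ {z : ℂ | z ≠ 0} := fun z hz =>
      hA0 z (hball (Metric.sphere_subset_closedBall hz))
    have key := hψ.le_circleAverage (a := a) (b := b) (c := ζ₀) hρ.le
      (fun z hz => hΩ z (hball hz).2) (k := fun z => (c + h ζ₀) - h z)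
      (by have := hcont.mono hsph; fun_prop)
      (fun z hz => by
        have := hle (hmax' z (hball (Metric.sphere_subset_closedBall hz)))
        rw [hc] at this
        exact_mod_cast this)
    rw [hc, EReal.coe_le_coe_iff] at key
    have hci : ∀ f : ℂ → ℝ, ContinuousOn f {z | z ≠ 0} → CircleIntegrable f ζ₀ ρ := fun f hf =>
      (hf.mono hsph).circleIntegrable hρ.le
    have i1 : CircleIntegrable (fun z => ε • (‖z‖ ^ 2)) ζ₀ ρ := hci _ (by fun_prop)
    have i2 : CircleIntegrable (fun z => β • Real.log ‖z‖) ζ₀ ρ := hci _ (by fun_prop)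
    have i3 : CircleIntegrable (fun _ : ℂ => c + h ζ₀ + α) ζ₀ ρ := hci _ (by fun_prop)
    have hform : (fun z => (c + h ζ₀) - h z) =
        (fun _ : ℂ => c + h ζ₀ + α) + (fun z => β • Real.log ‖z‖)
          - (fun z => ε • (‖z‖ ^ 2)) := by
      funext z
      simp [hh]; ring
    rw [hform, Real.circleAverage_sub (i3.add i2) i1, Real.circleAverage_add i3 i2,
      Real.circleAverage_fun_smul, Real.circleAverage_fun_smul, circleAverage_normSq,
      circleAverage_log_norm hρ.le (by linarith), Real.circleAverage_const] at key
    simp only [hh, smul_eq_mul] at key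
    have : 0 < ε * ρ ^ 2 := by positivity
    linarith
  have := hle ((hmax' ζ ⟨h1, h2⟩).trans hfin)
  refine this.trans ?_
  rw [← EReal.coe_sub, EReal.coe_le_coe_iff, hh]
  have : 0 ≤ ε * ‖ζ‖ ^ 2 := by positivity
  simp only
  linarith

/-! ### Sub-mean value inequality over balls -/

/-- The normalized Lebesgue measure on `(0, 2π]`. -/
def angularMeasure : Measure ℝ :=
  ((volume.restrict (Ioc 0 (2 * Real.pi))) univ)⁻¹ • volume.restrict (Ioc 0 (2 * Real.pi))

instance : IsProbabilityMeasure angularMeasure := by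
  constructor
  have := Real.pi_pos
  simp only [angularMeasure, Measure.smul_apply, Measure.restrict_apply_univ, Real.volume_Ioc,
    sub_zero, smul_eq_mul]
  exact ENNReal.inv_mul_cancel (by simpa using this) ENNReal.ofReal_ne_top

theorem angularMean_eq (g : ℝ → EReal) :
    angularMean g = ((∫⁻ θ, (g θ).toENNReal ∂angularMeasure : ℝ≥0∞) : EReal)
      - ((∫⁻ θ, (-g θ).toENNReal ∂angularMeasure : ℝ≥0∞) : EReal) := rfl

/-- Written with sums only, since subtraction in `ℝ≥0∞` truncates; at `x = ⊥` both sides are `∞`. -/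
theorem toENNReal_sub_add_toENNReal {N : ℝ} {x : EReal} (hx : x ≤ N) :
    ((N : EReal) - x).toENNReal + (x.toENNReal + ENNReal.ofReal (-N)) =
      ENNReal.ofReal N + (-x).toENNReal := by
  induction x with
  | bot => simp
  | top => simp at hx
  | coe x =>
    have hx : x ≤ N := by exact_mod_cast hx
    rw [← EReal.coe_sub, ← EReal.coe_neg]
    simp only [EReal.real_coe_toENNReal]
    rw [← ENNReal.toReal_eq_toReal_iff' (by finiteness) (by finiteness),
      ENNReal.toReal_add (by finiteness) (by finiteness),
      ENNReal.toReal_add (by finiteness) (by finiteness),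
      ENNReal.toReal_add (by finiteness) (by finiteness)]
    simp only [ENNReal.toReal_ofReal']
    rw [max_eq_left (sub_nonneg.2 hx)]
    have e1 := max_zero_sub_max_neg_zero_eq_self x
    have e2 := max_zero_sub_max_neg_zero_eq_self N
    linarith

/-- Passing to the nonnegative function `N - g` allows Tonelli to be used later with no
integrability assumption. -/
theorem lintegral_toENNReal_sub_le {g : ℝ → EReal} (hg : Measurable g) {N : ℝ}
    (hN : ∀ θ, g θ ≤ N) {p : EReal} (hp : p ≤ angularMean g) (hpt : p ≠ ⊤) :
    ∫⁻ θ, ((N : EReal) - g θ).toENNReal ∂angularMeasure ≤ ((N : EReal) - p).toENNReal := by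
  rcases eq_or_ne p ⊥ with rfl | hpb
  · simp
  lift p to ℝ using ⟨hpt, hpb⟩
  rw [angularMean_eq] at hp
  set F := ∫⁻ θ, ((N : EReal) - g θ).toENNReal ∂angularMeasure
  set P := ∫⁻ θ, (g θ).toENNReal ∂angularMeasure with hP
  set Q := ∫⁻ θ, (-g θ).toENNReal ∂angularMeasure with hQ
  have hPfin : P ≠ ∞ := by
    refine ne_top_of_le_ne_top (b := ENNReal.ofReal N) ENNReal.ofReal_ne_top ?_
    calc P ≤ ∫⁻ _, ENNReal.ofReal N ∂angularMeasure :=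
          lintegral_mono fun θ => EReal.toENNReal_le_toENNReal (hN θ)
      _ = _ := by simp
  -- An infinite negative part would make the mean `⊥`, below the finite `p`.
  have hQfin : Q ≠ ∞ := by
    intro h
    rw [h, ← EReal.coe_ennreal_toReal hPfin] at hp
    simp at hp
  have key : F + (P + ENNReal.ofReal (-N)) = ENNReal.ofReal N + Q := by
    have m1 : Measurable fun θ => (g θ).toENNReal := measurable_ereal_toENNReal.comp hg
    have m2 : Measurable fun θ => (-g θ).toENNReal := measurable_ereal_toENNReal.comp hg.neg
    have e1 : P + ENNReal.ofReal (-N) =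
        ∫⁻ θ, ((g θ).toENNReal + ENNReal.ofReal (-N)) ∂angularMeasure := by
      rw [lintegral_add_right _ measurable_const]; simp [P]
    have e2 : ENNReal.ofReal N + Q =
        ∫⁻ θ, (ENNReal.ofReal N + (-g θ).toENNReal) ∂angularMeasure := by
      rw [lintegral_add_left measurable_const]; simp [Q]
    rw [e1, e2, ← lintegral_add_right _ (m1.add_const _)]
    exact lintegral_congr fun θ => toENNReal_sub_add_toENNReal (hN θ)
  have hFfin : F ≠ ∞ := by
    refine ne_top_of_le_ne_top (b := ENNReal.ofReal N + Q) (by finiteness) ?_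
    rw [← key]; exact le_self_add
  rw [← EReal.coe_ennreal_toReal hPfin, ← EReal.coe_ennreal_toReal hQfin, ← EReal.coe_sub,
    EReal.coe_le_coe_iff] at hp
  rw [← EReal.coe_sub, EReal.real_coe_toENNReal, ← ENNReal.ofReal_toReal hFfin]
  refine ENNReal.ofReal_le_ofReal ?_
  have := congrArg ENNReal.toReal key
  rw [ENNReal.toReal_add hFfin (by finiteness),
    ENNReal.toReal_add hPfin (by finiteness),
    ENNReal.toReal_add (by finiteness) hQfin] at this
  simp only [ENNReal.toReal_ofReal'] at this
  have e2 := max_zero_sub_max_neg_zero_eq_self N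
  linarith

/-- A semicontinuous function on an open set agrees there with a measurable function. -/
theorem IsPlurisubharmonicOn.exists_measurable (hψ : IsPlurisubharmonicOn ψ Ω) (hΩ : IsOpen Ω) :
    ∃ φ : EuclideanSpace ℂ (Fin n) → EReal, Measurable φ ∧ EqOn φ ψ Ω := by
  classical
  -- The value `⊤` off `Ω` makes upper semicontinuity vacuous there; openness of `Ω` handles the
  -- other points.
  refine ⟨fun z => if z ∈ Ω then ψ z else ⊤, ?_, fun z hz => by simp [hz]⟩
  refine UpperSemicontinuous.measurable (fun z y hy => ?_)
  by_cases hz : z ∈ Ω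
  · have h1 := hψ.upperSemicontinuousOn z hz y (by simpa [hz] using hy)
    rw [hΩ.nhdsWithin_eq hz] at h1
    filter_upwards [h1, hΩ.mem_nhds hz] with w hw hwΩ
    simpa [hwΩ] using hw
  · simp [hz] at hy

theorem lintegral_comp_add_smul (H : EuclideanSpace ℂ (Fin n) → ℝ≥0∞)
    (x : EuclideanSpace ℂ (Fin n)) {c : ℂ} (hc : ‖c‖ = 1) :
    ∫⁻ w, H (x + c • w) = ∫⁻ w, H w := by
  have hc0 : c ≠ 0 := norm_ne_zero_iff.1 (by rw [hc]; exact one_ne_zero)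
  let e : EuclideanSpace ℂ (Fin n) ≃ₗᵢ[ℝ] EuclideanSpace ℂ (Fin n) :=
    { DistribMulAction.toLinearEquiv ℝ (EuclideanSpace ℂ (Fin n)) (Units.mk0 c hc0) with
      norm_map' := fun w => by
        change ‖c • w‖ = ‖w‖
        rw [norm_smul, hc, one_mul] }
  have he : ∀ w, e w = c • w := fun _ => rfl
  calc ∫⁻ w, H (x + c • w) = ∫⁻ w, H (x + e w) := by simp only [he]
    _ = ∫⁻ w, H (x + w) :=
      e.measurePreserving.lintegral_comp_emb e.toHomeomorph.measurableEmbedding (fun w => H (x + w))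
    _ = ∫⁻ w, H w := lintegral_add_left_eq_self H x

/-- The sub-mean value inequality over balls, for the nonnegative function `N - ψ`. -/
theorem IsPlurisubharmonicOn.setLIntegral_ball_le (hψ : IsPlurisubharmonicOn ψ Ω)
    (hΩ : IsOpen Ω) {x : EuclideanSpace ℂ (Fin n)} {s : ℝ} (hs : 0 < s)
    (hsub : Metric.ball x s ⊆ Ω) {N : ℝ} (hN : ∀ z ∈ Metric.ball x s, ψ z ≤ N) :
    ∫⁻ z in Metric.ball x s, ((N : EReal) - ψ z).toENNReal ≤
      volume (Metric.ball x s) * ((N : EReal) - ψ x).toENNReal := by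
  obtain ⟨φ, hφm, hφ⟩ := hψ.exists_measurable hΩ
  set H : EuclideanSpace ℂ (Fin n) → ℝ≥0∞ :=
    (Metric.ball x s).indicator fun z => ((N : EReal) - φ z).toENNReal with hH
  have hHm : Measurable H :=
    (measurable_ereal_toENNReal.comp (by fun_prop)).indicator measurableSet_ball
  have hmem : ∀ (c : ℂ) (w : EuclideanSpace ℂ (Fin n)), ‖c‖ ≤ 1 → w ∈ Metric.ball 0 s →
      x + c • w ∈ Metric.ball x s := by
    intro c w hc hw
    rw [mem_ball_iff_norm, add_sub_cancel_left, norm_smul]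
    rw [mem_ball_zero_iff] at hw
    nlinarith [norm_nonneg w, norm_nonneg c]
  have hexp : ∀ θ : ℝ, ‖Complex.exp (θ * Complex.I)‖ = 1 := Complex.norm_exp_ofReal_mul_I
  have hpt : ∀ w, ∫⁻ θ, H (x + Complex.exp ((θ : ℝ) * Complex.I) • w) ∂angularMeasure ≤
      (Metric.ball 0 s).indicator (fun _ => ((N : EReal) - ψ x).toENNReal) w := by
    intro w
    by_cases hw : w ∈ Metric.ball (0 : EuclideanSpace ℂ (Fin n)) s
    · rw [indicator_of_mem hw]
      have hin : ∀ θ : ℝ, x + Complex.exp (θ * Complex.I) • w ∈ Metric.ball x s := fun θ =>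
        hmem _ w (hexp θ).le hw
      have heq : ∀ θ : ℝ, φ (x + Complex.exp (θ * Complex.I) • w) =
          ψ (x + Complex.exp (θ * Complex.I) • w) := fun θ => hφ (hsub (hin θ))
      simp only [hH, indicator_of_mem (hin _)]
      refine lintegral_toENNReal_sub_le (g := fun θ => φ (x + Complex.exp (θ * Complex.I) • w))
        (hφm.comp (by fun_prop)) (fun θ => ?_) ?_
        (hψ.lt_top x (hsub (Metric.mem_ball_self hs))).ne
      · rw [heq]; exact hN _ (hin θ)
      · simp only [heq]
        exact hψ.le_angularMean x w fun ζ hζ => hsub (hmem ζ w hζ hw)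
    · rw [indicator_of_notMem hw, nonpos_iff_eq_zero]
      have : ∀ θ : ℝ, H (x + Complex.exp (θ * Complex.I) • w) = 0 := by
        intro θ
        refine indicator_of_notMem ?_ _
        rw [mem_ball_iff_norm, add_sub_cancel_left, norm_smul, hexp, one_mul]
        rwa [mem_ball_zero_iff] at hw
      simp [this]
  calc ∫⁻ z in Metric.ball x s, ((N : EReal) - ψ z).toENNReal = ∫⁻ z, H z := by
        rw [hH, lintegral_indicator measurableSet_ball]
        exact setLIntegral_congr_fun measurableSet_ball fun z hz => by simp only [hφ (hsub hz)]
    -- Each rotation `w ↦ exp(iθ) w` preserves volume, so averaging over `θ` changes nothing; after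
    -- Tonelli the inner integral is a circle mean.
    _ = ∫⁻ θ, ∫⁻ w, H (x + Complex.exp ((θ : ℝ) * Complex.I) • w) ∂volume ∂angularMeasure := by
        simp [lintegral_comp_add_smul H x (hexp _)]
    _ = ∫⁻ w, ∫⁻ θ, H (x + Complex.exp ((θ : ℝ) * Complex.I) • w) ∂angularMeasure ∂volume := by
        refine lintegral_lintegral_swap (Measurable.aemeasurable ?_)
        refine hHm.comp (Continuous.measurable ?_)
        fun_prop
    _ ≤ ∫⁻ w, (Metric.ball 0 s).indicator (fun _ => ((N : EReal) - ψ x).toENNReal) w :=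
        lintegral_mono hpt
    _ = volume (Metric.ball x s) * ((N : EReal) - ψ x).toENNReal := by
        rw [lintegral_indicator measurableSet_ball, setLIntegral_const, mul_comm,
          ← Measure.addHaar_ball_center volume x]

/-! ### Three circles and doubling -/

/-- Hadamard's three circles inequality for plurisubharmonic functions. -/
theorem IsPlurisubharmonicOn.le_three_spheres (hψ : IsPlurisubharmonicOn ψ Ω)
    {a : EuclideanSpace ℂ (Fin n)} {r R : ℝ} (hr : 0 < r) (hrR : r < R)
    (hsub : Metric.closedBall a R ⊆ Ω) {m₁ m₂ : ℝ}
    (h₁ : ∀ z ∈ Metric.sphere a r, ψ z ≤ m₁) (h₂ : ∀ z ∈ Metric.sphere a R, ψ z ≤ m₂)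
    {z : EuclideanSpace ℂ (Fin n)} (hz₁ : r ≤ ‖z - a‖) (hz₂ : ‖z - a‖ ≤ R) :
    ψ z ≤ (m₁ + (m₂ - m₁) / Real.log (R / r) * Real.log (‖z - a‖ / r) : ℝ) := by
  have ht : 0 < ‖z - a‖ := hr.trans_le hz₁
  have hT : 0 < Real.log (R / r) := Real.log_pos ((one_lt_div hr).2 hrR)
  set β := (m₂ - m₁) / Real.log (R / r) with hβ
  -- The unit vector `b` spans the line through `a` and `z`, so `‖ζ‖` is the distance from `a`.
  set b := ((‖z - a‖⁻¹ : ℝ) : ℂ) • (z - a) with hb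
  have hbn : ‖b‖ = 1 := by
    rw [hb, norm_smul, Complex.norm_real, norm_inv, norm_norm, inv_mul_cancel₀ ht.ne']
  have hn : ∀ ζ : ℂ, ‖a + ζ • b - a‖ = ‖ζ‖ := fun ζ => by
    rw [add_sub_cancel_left, norm_smul, hbn, mul_one]
  have key := hψ.le_log_of_annulus (a := a) (b := b) (r := r) (R := R) hr
    (fun ζ hζ => hsub (by rw [mem_closedBall_iff_norm, hn]; exact hζ))
    (α := m₁ - β * Real.log r) (β := β)
    (fun ζ hζ => by
      rcases hζ with hζ | hζ
      · refine (h₁ _ (by rw [mem_sphere_iff_norm, hn]; exact hζ)).trans ?_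
        rw [hζ, EReal.coe_le_coe_iff]; linarith
      · refine (h₂ _ (by rw [mem_sphere_iff_norm, hn]; exact hζ)).trans ?_
        rw [hζ, EReal.coe_le_coe_iff]
        have : β * Real.log (R / r) = m₂ - m₁ := by rw [hβ]; field_simp
        rw [Real.log_div (hr.trans hrR).ne' hr.ne'] at this
        linarith)
    (ζ := ((‖z - a‖ : ℝ) : ℂ)) (by simpa using hz₁) (by simpa using hz₂)
  have e : a + ((‖z - a‖ : ℝ) : ℂ) • b = z := by
    rw [hb, smul_smul, ← Complex.ofReal_mul, mul_inv_cancel₀ ht.ne']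
    simp
  rw [e] at key
  refine key.trans (EReal.coe_le_coe_iff.2 ?_)
  rw [Real.log_div ht.ne' hr.ne', Complex.norm_real, norm_norm]
  linarith

/-- Doubling: the maximum of `ψ` over a small ball is comparable with its supremum over a four
times larger ball, with an error controlled at a fixed scale. -/
theorem IsPlurisubharmonicOn.exists_le_add_of_closedBall (hψ : IsPlurisubharmonicOn ψ Ω)
    {a : EuclideanSpace ℂ (Fin n)} {r R : ℝ} (hr : 0 < r) (hrR : 4 * r ≤ R)
    (hsub : Metric.closedBall a R ⊆ Ω) {M l : ℝ} (hM : ∀ z ∈ Metric.closedBall a R, ψ z ≤ M)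
    {p q : EuclideanSpace ℂ (Fin n)} (hp : ‖p - a‖ ≤ R / 2) (hlp : (l : EReal) ≤ ψ p)
    (hq : q ∈ Metric.closedBall a r) (hqb : ψ q ≠ ⊥) :
    ∃ x ∈ Metric.closedBall a r, ∃ m : ℝ, ψ x = m ∧
      ∀ z ∈ Metric.closedBall a (4 * r), ψ z ≤ (m + 2 * (M - l) : ℝ) := by
  have hsubr : Metric.closedBall a r ⊆ Metric.closedBall a R :=
    Metric.closedBall_subset_closedBall (by linarith)
  obtain ⟨x, hx, hmax⟩ := (hψ.upperSemicontinuousOn.mono (hsubr.trans hsub)).exists_isMaxOn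
    ⟨q, hq⟩ (isCompact_closedBall a r)
  have hmax' : ∀ z ∈ Metric.closedBall a r, ψ z ≤ ψ x := fun z hz => hmax hz
  obtain ⟨m, hm⟩ : ∃ m : ℝ, ψ x = m := by
    refine ⟨_, (EReal.coe_toReal (hψ.lt_top _ (hsub (hsubr hx))).ne fun h => hqb ?_).symm⟩
    exact le_bot_iff.1 (h ▸ hmax' q hq)
  refine ⟨x, hx, m, hm, ?_⟩
  rw [hm] at hmax'
  have hmM : m ≤ M := by
    have := hM x (hsubr hx)
    rw [hm] at this
    exact_mod_cast this
  have hlM : l ≤ M := by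
    have hpR : p ∈ Metric.closedBall a R := by
      rw [mem_closedBall_iff_norm]; linarith
    exact_mod_cast hlp.trans (hM p hpR)
  have hlog2 : 0 < Real.log 2 := Real.log_pos (by norm_num)
  have hlog4 : Real.log 4 = 2 * Real.log 2 := by
    rw [show (4 : ℝ) = 2 ^ 2 by norm_num, Real.log_pow]; norm_num
  set T := Real.log (R / r) with hT
  have hTpos : 0 < T := Real.log_pos ((one_lt_div hr).2 (by linarith))
  set β := (M - m) / T with hβ
  have hβ0 : 0 ≤ β := div_nonneg (by linarith) hTpos.le
  have hβT : β * T = M - m := by rw [hβ]; field_simp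
  have three := fun {z : EuclideanSpace ℂ (Fin n)} =>
    hψ.le_three_spheres (z := z) hr (by linarith : r < R) hsub
    (fun z hz => hmax' z (Metric.sphere_subset_closedBall hz))
    (fun z hz => hM z (Metric.sphere_subset_closedBall hz))
  -- Since `p` lies within `R / 2`, its logarithmic radius is at most `T - log 2`, whence `l ≤ M - β
  -- log 2`. If `p` lies in the small ball, `l ≤ m` and `log 2 ≤ T` give the same bound.
  have hslope : β * Real.log 2 ≤ M - l := by
    rcases le_total r ‖p - a‖ with hpr | hpr
    · have h := hlp.trans (three hpr (by linarith))
      rw [EReal.coe_le_coe_iff] at h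
      have : Real.log (‖p - a‖ / r) ≤ T - Real.log 2 := by
        rw [hT, ← Real.log_div (div_pos (by linarith) hr).ne' (by norm_num)]
        refine Real.log_le_log (div_pos (hr.trans_le hpr) hr) ?_
        rw [div_right_comm]
        gcongr
      have h3 := mul_le_mul_of_nonneg_left this hβ0
      linarith
    · have h := hlp.trans (hmax' p (by rwa [mem_closedBall_iff_norm]))
      rw [EReal.coe_le_coe_iff] at h
      have : Real.log 2 ≤ T := by
        rw [hT]
        refine Real.log_le_log (by norm_num) ?_
        rw [le_div_iff₀ hr]; linarith
      have h3 := mul_le_mul_of_nonneg_left this hβ0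
      linarith
  intro z hz
  rcases le_total r ‖z - a‖ with hzr | hzr
  · rw [mem_closedBall_iff_norm] at hz
    refine (three hzr (by linarith)).trans (EReal.coe_le_coe_iff.2 ?_)
    -- The factor 2 in the doubling bound is `log 4 / log 2`.
    have : Real.log (‖z - a‖ / r) ≤ 2 * Real.log 2 := by
      rw [← hlog4]
      refine Real.log_le_log (div_pos (hr.trans_le hzr) hr) ?_
      rw [div_le_iff₀ hr]; linarith
    have h3 := mul_le_mul_of_nonneg_left this hβ0
    linarith
  · refine (hmax' z (by rwa [mem_closedBall_iff_norm])).trans (EReal.coe_le_coe_iff.2 ?_)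
    linarith

/-! ### Almost everywhere finiteness and local integrability -/

theorem IsPlurisubharmonicOn.exists_forall_le (hψ : IsPlurisubharmonicOn ψ Ω)
    {K : Set (EuclideanSpace ℂ (Fin n))} (hK : IsCompact K) (hsub : K ⊆ Ω) :
    ∃ M : ℝ, ∀ z ∈ K, ψ z ≤ M := by
  rcases K.eq_empty_or_nonempty with rfl | hne
  · exact ⟨0, by simp⟩
  obtain ⟨x, hx, hmax⟩ := (hψ.upperSemicontinuousOn.mono hsub).exists_isMaxOn hne hK
  obtain ⟨M, hM, -⟩ := EReal.lt_iff_exists_real_btwn.1 (hψ.lt_top x (hsub hx))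
  exact ⟨M, fun z hz => (show ψ z ≤ ψ x from hmax hz).trans hM.le⟩

/-- The default `(⊥ : EReal).toReal = 0` is harmless, since the right side is `∞` at `⊥`. -/
theorem enorm_toReal_sub_le {x : EReal} {N : ℝ} (hx : x ≤ N) :
    ‖x.toReal - N‖ₑ ≤ ((N : EReal) - x).toENNReal := by
  induction x with
  | bot => simp
  | top => simp at hx
  | coe x =>
    have hx : x ≤ N := by exact_mod_cast hx
    rw [EReal.toReal_coe, ← EReal.coe_sub, EReal.real_coe_toENNReal, ← ofReal_norm,
      Real.norm_eq_abs, abs_sub_comm, abs_of_nonneg (sub_nonneg.2 hx)]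

/-- The points with a neighbourhood on which `ψ` is bounded above and integrable. -/
def integrabilitySet (ψ : EuclideanSpace ℂ (Fin n) → EReal) (Ω : Set (EuclideanSpace ℂ (Fin n))) :
    Set (EuclideanSpace ℂ (Fin n)) :=
  {x | ∃ s > 0, ∃ N : ℝ, Metric.ball x s ⊆ Ω ∧ (∀ z ∈ Metric.ball x s, ψ z ≤ N) ∧
    ∫⁻ z in Metric.ball x s, ((N : EReal) - ψ z).toENNReal ≠ ∞}

theorem mem_integrabilitySet_of_mem_ball {y z : EuclideanSpace ℂ (Fin n)} {R N : ℝ}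
    (hsub : Metric.ball y R ⊆ Ω) (hN : ∀ w ∈ Metric.ball y R, ψ w ≤ N)
    (hfin : ∫⁻ w in Metric.ball y R, ((N : EReal) - ψ w).toENNReal ≠ ∞)
    (hz : z ∈ Metric.ball y R) : z ∈ integrabilitySet ψ Ω := by
  obtain ⟨s, hs, hss⟩ := Metric.isOpen_iff.1 Metric.isOpen_ball z hz
  exact ⟨s, hs, N, hss.trans hsub, fun w hw => hN w (hss hw),
    ne_top_of_le_ne_top hfin (lintegral_mono_set hss)⟩

theorem isOpen_integrabilitySet : IsOpen (integrabilitySet ψ Ω) := by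
  rw [Metric.isOpen_iff]
  rintro x ⟨s, hs, N, h1, h2, h3⟩
  exact ⟨s, hs, fun z hz => mem_integrabilitySet_of_mem_ball h1 h2 h3 hz⟩

theorem IsPlurisubharmonicOn.ae_ne_bot (hψ : IsPlurisubharmonicOn ψ Ω) (hΩ : IsOpen Ω)
    {S : Set (EuclideanSpace ℂ (Fin n))} (hS : MeasurableSet S) (hsub : S ⊆ Ω) {N : ℝ}
    (hfin : ∫⁻ w in S, ((N : EReal) - ψ w).toENNReal ≠ ∞) :
    ∀ᵐ w ∂volume.restrict S, ψ w ≠ ⊥ := by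
  obtain ⟨φ, hφm, hφ⟩ := hψ.exists_measurable hΩ
  have e : ∫⁻ w in S, ((N : EReal) - φ w).toENNReal ≠ ∞ := by
    rw [setLIntegral_congr_fun hS (g := fun w => ((N : EReal) - ψ w).toENNReal)
      fun z hz => by simp only [hφ (hsub hz)]]
    exact hfin
  have hm : Measurable fun w => ((N : EReal) - φ w).toENNReal :=
    Measurable.ereal_toENNReal (by fun_prop)
  filter_upwards [ae_lt_top hm e, ae_restrict_mem hS] with w hw hwS hbot
  rw [hφ (hsub hwS), hbot] at hw
  simp at hw

theorem IsPlurisubharmonicOn.exists_mem_ball_ne_bot (hψ : IsPlurisubharmonicOn ψ Ω)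
    (hΩ : IsOpen Ω) {x : EuclideanSpace ℂ (Fin n)} (hx : x ∈ integrabilitySet ψ Ω) {r : ℝ}
    (hr : 0 < r) : ∃ q ∈ Metric.ball x r, ψ q ≠ ⊥ := by
  obtain ⟨s, hs, N, h1, h2, h3⟩ := hx
  have hae := hψ.ae_ne_bot hΩ measurableSet_ball h1 h3
  by_contra! hcon
  have h0 : volume.restrict (Metric.ball x s) (Metric.ball x r) = 0 :=
    measure_mono_null (fun q hq => by simpa using hcon q hq) (ae_iff.1 hae)
  rw [Measure.restrict_apply measurableSet_ball] at h0
  have : Metric.ball x (min r s) ⊆ Metric.ball x r ∩ Metric.ball x s :=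
    subset_inter (Metric.ball_subset_ball (min_le_left _ _))
      (Metric.ball_subset_ball (min_le_right _ _))
  exact (Metric.measure_ball_pos volume x (lt_min hr hs)).ne' (measure_mono_null this h0)

/-- The sub-mean value inequality about a point with `ψ ≠ ⊥` gives integrability on a whole ball.
Points of the integrability set have such points arbitrarily near, so the set is relatively closed
in `Ω`; being open and nonempty, it is all of `Ω` by connectedness. -/
theorem IsPlurisubharmonicOn.subset_integrabilitySet (hψ : IsPlurisubharmonicOn ψ Ω)
    (hΩ : IsDomainSet Ω) (hne : ∃ z ∈ Ω, ψ z ≠ ⊥) : Ω ⊆ integrabilitySet ψ Ω := by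
  have hmem : ∀ {y z : EuclideanSpace ℂ (Fin n)} {R : ℝ}, 0 < R → ψ y ≠ ⊥ →
      Metric.closedBall y R ⊆ Ω → z ∈ Metric.ball y R → z ∈ integrabilitySet ψ Ω := by
    intro y z R hR hy hsub hz
    obtain ⟨N, hN⟩ := hψ.exists_forall_le (isCompact_closedBall y R) hsub
    have hsub' := Metric.ball_subset_closedBall.trans hsub
    have hN' : ∀ w ∈ Metric.ball y R, ψ w ≤ N := fun w hw =>
      hN w (Metric.ball_subset_closedBall hw)
    refine mem_integrabilitySet_of_mem_ball hsub' hN' ?_ hz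
    refine ne_top_of_le_ne_top ?_ (hψ.setLIntegral_ball_le hΩ.1 hR hsub' hN')
    refine ENNReal.mul_ne_top measure_ball_lt_top.ne ?_
    lift ψ y to ℝ using ⟨(hψ.lt_top y (hsub' (Metric.mem_ball_self hR))).ne, hy⟩ with t
    rw [← EReal.coe_sub, EReal.real_coe_toENNReal]
    finiteness
  have hnhds : ∀ x ∈ Ω, ∃ R > 0, Metric.closedBall x R ⊆ Ω := fun x hx =>
    Metric.nhds_basis_closedBall.mem_iff.1 (hΩ.1.mem_nhds hx)
  refine hΩ.2.isPreconnected.subset_of_closure_inter_subset isOpen_integrabilitySet ?_ ?_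
  · obtain ⟨z, hz, hzb⟩ := hne
    obtain ⟨R, hR, hsub⟩ := hnhds z hz
    exact ⟨z, hz, hmem hR hzb hsub (Metric.mem_ball_self hR)⟩
  · rintro x ⟨hxc, hx⟩
    obtain ⟨R, hR, hsub⟩ := hnhds x hx
    obtain ⟨y, hy, hxy⟩ := Metric.mem_closure_iff.1 hxc (R / 4) (by positivity)
    obtain ⟨q, hq, hqb⟩ := hψ.exists_mem_ball_ne_bot hΩ.1 hy (show 0 < R / 4 by positivity)
    have hqx : dist q x < R / 2 := by
      have := dist_triangle q y x
      rw [dist_comm x y] at hxy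
      rw [Metric.mem_ball] at hq
      linarith
    -- The ball of radius `R / 2` about `q` contains `x` and stays inside the `R`-ball about `x`.
    refine hmem (half_pos hR) hqb ((Metric.closedBall_subset_closedBall' ?_).trans hsub)
      (by rw [Metric.mem_ball, dist_comm]; exact hqx)
    linarith

theorem IsPlurisubharmonicOn.ae_finite (hψ : IsPlurisubharmonicOn ψ Ω)
    (hΩ : IsDomainSet Ω) (hne : ∃ z ∈ Ω, ψ z ≠ ⊥) :
    ∀ᵐ x ∂(volume.restrict Ω), ψ x ≠ ⊥ ∧ ψ x ≠ ⊤ := by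
  have hnull : volume {x ∈ Ω | ψ x = ⊥} = 0 := by
    refine measure_null_of_locally_null _ fun x hx => ?_
    obtain ⟨s, hs, N, h1, h2, h3⟩ := hψ.subset_integrabilitySet hΩ hne hx.1
    refine ⟨{x ∈ Ω | ψ x = ⊥} ∩ Metric.ball x s,
      Filter.inter_mem self_mem_nhdsWithin (mem_nhdsWithin_of_mem_nhds (Metric.ball_mem_nhds x hs)), ?_⟩
    have hae := ae_iff.1 (hψ.ae_ne_bot hΩ.1 measurableSet_ball h1 h3)
    rw [Measure.restrict_apply' measurableSet_ball] at hae
    exact measure_mono_null (inter_subset_inter_left _ fun z hz => by simpa using hz.2) hae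
  rw [ae_restrict_iff' hΩ.1.measurableSet]
  filter_upwards [measure_eq_zero_iff_ae_notMem.1 hnull] with x hx hxΩ
  exact ⟨fun h => hx ⟨hxΩ, h⟩, (hψ.lt_top x hxΩ).ne⟩

theorem IsPlurisubharmonicOn.locallyIntegrableOn (hψ : IsPlurisubharmonicOn ψ Ω)
    (hΩ : IsDomainSet Ω) (hne : ∃ z ∈ Ω, ψ z ≠ ⊥) :
    LocallyIntegrableOn (fun x => (ψ x).toReal) Ω volume := by
  intro x hx
  obtain ⟨s, hs, N, h1, h2, h3⟩ := hψ.subset_integrabilitySet hΩ hne hx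
  refine ⟨Metric.ball x s, mem_nhdsWithin_of_mem_nhds (Metric.ball_mem_nhds x hs), ?_⟩
  obtain ⟨φ, hφm, hφ⟩ := hψ.exists_measurable hΩ.1
  have hmeas : AEStronglyMeasurable (fun x => (ψ x).toReal)
      (volume.restrict (Metric.ball x s)) := by
    refine (hφm.ereal_toReal.aestronglyMeasurable).congr ?_
    filter_upwards [ae_restrict_mem measurableSet_ball] with z hz
    rw [hφ (h1 hz)]
  have hsub : IntegrableOn (fun x => (ψ x).toReal - N) (Metric.ball x s) := by
    refine ⟨hmeas.sub aestronglyMeasurable_const, lt_of_le_of_lt ?_ (lt_top_iff_ne_top.2 h3)⟩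
    exact setLIntegral_mono' measurableSet_ball fun z hz => enorm_toReal_sub_le (h2 z hz)
  have hc : IntegrableOn (fun _ => N) (Metric.ball x s) :=
    integrableOn_const measure_ball_lt_top.ne
  refine (hsub.add hc).congr_fun (fun z _ => ?_) measurableSet_ball
  simp

/-! ### Mean oscillation estimates -/

/-- The mean oscillation is at most twice the mean distance to any constant. -/
theorem setLAverage_enorm_sub_average_le {α : Type*} [MeasurableSpace α] {μ : Measure α}
    {f : α → ℝ} {B : Set α} (hf : IntegrableOn f B μ) (h0 : μ B ≠ 0) (hB : μ B ≠ ∞) (c : ℝ) :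
    ⨍⁻ x in B, ‖f x - ⨍ y in B, f y ∂μ‖ₑ ∂μ ≤ 2 * ⨍⁻ x in B, ‖f x - c‖ₑ ∂μ := by
  have hc : IntegrableOn (fun _ => c) B μ := integrableOn_const hB
  have hμ : (μ.real B) ≠ 0 := (measureReal_ne_zero_iff hB).2 h0
  have havg : c - ⨍ y in B, f y ∂μ = -⨍ y in B, (f y - c) ∂μ := by
    rw [setAverage_eq, setAverage_eq, integral_sub hf hc, setIntegral_const]
    simp only [smul_eq_mul]
    field_simp
    ring
  have hle : ‖c - ⨍ y in B, f y ∂μ‖ₑ ≤ ⨍⁻ x in B, ‖f x - c‖ₑ ∂μ := by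
    rw [havg, enorm_neg, setAverage_eq, setLAverage_eq, enorm_smul, div_eq_mul_inv, mul_comm]
    gcongr
    · exact enorm_integral_le_lintegral_enorm _
    · rw [enorm_inv hμ, Real.enorm_eq_ofReal measureReal_nonneg, Measure.real,
        ENNReal.ofReal_toReal hB]
  calc ⨍⁻ x in B, ‖f x - ⨍ y in B, f y ∂μ‖ₑ ∂μ
      ≤ ⨍⁻ x in B, (‖f x - c‖ₑ + ‖c - ⨍ y in B, f y ∂μ‖ₑ) ∂μ := by
        refine lintegral_mono fun x => ?_
        rw [← sub_add_sub_cancel (f x) c]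
        exact enorm_add_le _ _
    _ = ⨍⁻ x in B, ‖f x - c‖ₑ ∂μ + ‖c - ⨍ y in B, f y ∂μ‖ₑ := by
        rw [setLAverage_eq, setLAverage_eq, lintegral_add_right _ measurable_const,
          setLIntegral_const, ENNReal.add_div, ENNReal.mul_div_cancel_right h0 hB]
    _ ≤ _ := by rw [two_mul]; gcongr

theorem volume_ball_two_mul (x a : EuclideanSpace ℂ (Fin n)) (r : ℝ) :
    volume (Metric.ball x (2 * r)) =
      ENNReal.ofReal (2 ^ Module.finrank ℝ (EuclideanSpace ℂ (Fin n))) *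
        volume (Metric.ball a r) := by
  rw [Measure.addHaar_ball_mul_of_pos volume x two_pos, Measure.addHaar_ball_center volume a]

/-- Uniform estimate on small balls. -/
theorem IsPlurisubharmonicOn.exists_setLAverage_le (hψ : IsPlurisubharmonicOn ψ Ω)
    (hΩ : IsOpen Ω) {a : EuclideanSpace ℂ (Fin n)} {r R : ℝ} (hr : 0 < r) (hrR : 4 * r ≤ R)
    (hsub : Metric.closedBall a R ⊆ Ω) {M l : ℝ} (hM : ∀ z ∈ Metric.closedBall a R, ψ z ≤ M)
    {p q : EuclideanSpace ℂ (Fin n)} (hp : ‖p - a‖ ≤ R / 2) (hlp : (l : EReal) ≤ ψ p)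
    (hq : q ∈ Metric.closedBall a r) (hqb : ψ q ≠ ⊥) :
    ∃ c : ℝ, ⨍⁻ z in Metric.ball a r, ‖(ψ z).toReal - c‖ₑ ∂volume ≤
      ENNReal.ofReal (2 ^ Module.finrank ℝ (EuclideanSpace ℂ (Fin n))) *
        ENNReal.ofReal (2 * (M - l)) := by
  obtain ⟨x, hx, m, hm, hdbl⟩ := hψ.exists_le_add_of_closedBall hr hrR hsub hM hp hlp hq hqb
  rw [Metric.mem_closedBall] at hx
  set N := m + 2 * (M - l) with hN
  -- Recentring at the maximum point `x` makes `N - ψ x` exactly `2 * (M - l)`; doubling the radius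
  -- costs only a dimensional factor.
  have hbig : Metric.ball x (2 * r) ⊆ Metric.closedBall a (4 * r) :=
    Metric.ball_subset_closedBall.trans (Metric.closedBall_subset_closedBall' (by linarith))
  have hsmall : Metric.ball a r ⊆ Metric.ball x (2 * r) :=
    Metric.ball_subset_ball' (by rw [dist_comm]; linarith)
  have hbigΩ : Metric.ball x (2 * r) ⊆ Ω :=
    hbig.trans ((Metric.closedBall_subset_closedBall hrR).trans hsub)
  have hmean := hψ.setLIntegral_ball_le hΩ (by positivity) hbigΩ (N := N)
    fun z hz => hdbl z (hbig hz)
  refine ⟨N, ?_⟩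
  rw [setLAverage_eq]
  refine ENNReal.div_le_of_le_mul ?_
  calc ∫⁻ z in Metric.ball a r, ‖(ψ z).toReal - N‖ₑ
      ≤ ∫⁻ z in Metric.ball a r, ((N : EReal) - ψ z).toENNReal :=
        setLIntegral_mono' measurableSet_ball fun z hz =>
          enorm_toReal_sub_le (hdbl z (hbig (hsmall hz)))
    _ ≤ ∫⁻ z in Metric.ball x (2 * r), ((N : EReal) - ψ z).toENNReal := lintegral_mono_set hsmall
    _ ≤ volume (Metric.ball x (2 * r)) * ENNReal.ofReal (2 * (M - l)) := by
        rw [hm, ← EReal.coe_sub, EReal.real_coe_toENNReal, hN, add_sub_cancel_left] at hmean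
        exact hmean
    _ = _ := by rw [volume_ball_two_mul x a r]; ring

/-- A point `p` with `ψ p ≠ ⊥` near `x` serves every centre within `r / 2` of `x`; compactness
leaves finitely many values to minimise over. -/
theorem IsPlurisubharmonicOn.exists_uniform_lower_bound (hψ : IsPlurisubharmonicOn ψ Ω)
    (hΩ : IsDomainSet Ω) (hne : ∃ z ∈ Ω, ψ z ≠ ⊥) {K : Set (EuclideanSpace ℂ (Fin n))}
    (hK : IsCompact K) (hsub : K ⊆ Ω) {r : ℝ} (hr : 0 < r) :
    ∃ l : ℝ, ∀ a ∈ K, ∃ p, ‖p - a‖ ≤ r ∧ (l : EReal) ≤ ψ p := by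
  refine hK.induction_on (p := fun S => ∃ l : ℝ, ∀ a ∈ S, ∃ p, ‖p - a‖ ≤ r ∧ (l : EReal) ≤ ψ p)
    ⟨0, by simp⟩ ?_ ?_ ?_
  · rintro S T hST ⟨l, hl⟩
    exact ⟨l, fun a ha => hl a (hST ha)⟩
  · rintro S T ⟨l, hl⟩ ⟨l', hl'⟩
    refine ⟨min l l', fun a ha => ?_⟩
    rcases ha with ha | ha
    · obtain ⟨p, hp, hlp⟩ := hl a ha
      exact ⟨p, hp, (EReal.coe_le_coe_iff.2 (min_le_left _ _)).trans hlp⟩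
    · obtain ⟨p, hp, hlp⟩ := hl' a ha
      exact ⟨p, hp, (EReal.coe_le_coe_iff.2 (min_le_right _ _)).trans hlp⟩
  · intro x hx
    obtain ⟨p, hp, hpb⟩ := hψ.exists_mem_ball_ne_bot hΩ.1
      (hψ.subset_integrabilitySet hΩ hne (hsub hx)) (half_pos hr)
    obtain ⟨l, -, hl⟩ := EReal.lt_iff_exists_real_btwn.1 (bot_lt_iff_ne_bot.2 hpb)
    refine ⟨Metric.ball x (r / 2),
      mem_nhdsWithin_of_mem_nhds (Metric.ball_mem_nhds x (half_pos hr)), l, fun a ha =>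
      ⟨p, ?_, hl.le⟩⟩
    rw [← dist_eq_norm]
    rw [Metric.mem_ball] at hp ha
    have := dist_triangle_right p a x
    linarith

theorem IsPlurisubharmonicOn.bmoSeminorm_lt_top (hψ : IsPlurisubharmonicOn ψ Ω)
    (hΩ : IsDomainSet Ω) (hne : ∃ z ∈ Ω, ψ z ≠ ⊥) {U : Set (EuclideanSpace ℂ (Fin n))}
    (hU : CompactlyContained U Ω) : bmoSeminorm (fun x => (ψ x).toReal) U < ∞ := by
  obtain ⟨hK, hKΩ⟩ := hU
  obtain ⟨R, hR, hthick⟩ := hK.exists_cthickening_subset_open hΩ.1 hKΩ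
  obtain ⟨M, hM⟩ := hψ.exists_forall_le hK.cthickening hthick
  obtain ⟨l, hl⟩ := hψ.exists_uniform_lower_bound hΩ hne hK hKΩ (half_pos hR)
  have hint : IntegrableOn (fun x => (ψ x).toReal) (closure U) :=
    ((hψ.locallyIntegrableOn hΩ hne).mono_set hKΩ).integrableOn_isCompact hK
  have hintM : IntegrableOn (fun x => (ψ x).toReal - M) (closure U) :=
    hint.sub (integrableOn_const hK.measure_lt_top.ne)
  set C₁ : ℝ≥0∞ := ENNReal.ofReal (2 ^ Module.finrank ℝ (EuclideanSpace ℂ (Fin n))) *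
    ENNReal.ofReal (2 * (M - l))
  set v : ℝ≥0∞ := volume (Metric.ball (0 : EuclideanSpace ℂ (Fin n)) (R / 4)) with hv
  set C₂ : ℝ≥0∞ := (∫⁻ x in closure U, ‖(ψ x).toReal - M‖ₑ) / v
  have hC₂ : C₂ ≠ ∞ := ENNReal.div_ne_top hintM.2.ne
    (Metric.measure_ball_pos volume _ (by positivity)).ne'
  refine lt_of_le_of_lt (b := 2 * max C₁ C₂) ?_ (lt_top_iff_ne_top.2
    (ENNReal.mul_ne_top (by simp) (max_ne_top (by finiteness) hC₂)))
  refine iSup_le fun a => iSup_le fun r => iSup_le fun ⟨hr, hball⟩ => ?_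
  have hballK : Metric.ball a r ⊆ closure U := hball.trans subset_closure
  have haK : a ∈ closure U := hballK (Metric.mem_ball_self hr)
  suffices H : ∃ c : ℝ, ⨍⁻ z in Metric.ball a r, ‖(ψ z).toReal - c‖ₑ ∂volume ≤ max C₁ C₂ by
    obtain ⟨c, hc⟩ := H
    refine (setLAverage_enorm_sub_average_le (hint.mono_set hballK)
      (Metric.measure_ball_pos volume a hr).ne' measure_ball_lt_top.ne c).trans ?_
    gcongr
  -- Small balls use doubling at the fixed scale `R`; for large ones the `L¹` norm of `ψ - M` on
  -- `closure U` is divided by the volume of an `R / 4`-ball.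
  rcases le_total (4 * r) R with hrR | hrR
  · have hcl : Metric.closedBall a R ⊆ Metric.cthickening R (closure U) :=
      Metric.closedBall_subset_cthickening haK R
    obtain ⟨p, hp, hlp⟩ := hl a haK
    obtain ⟨q, hq, hqb⟩ := hψ.exists_mem_ball_ne_bot hΩ.1
      (hψ.subset_integrabilitySet hΩ hne (hKΩ haK)) hr
    obtain ⟨c, hc⟩ := hψ.exists_setLAverage_le hΩ.1 hr hrR (hcl.trans hthick)
      (fun z hz => hM z (hcl hz)) hp hlp (Metric.ball_subset_closedBall hq) hqb
    exact ⟨c, hc.trans (le_max_left _ _)⟩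
  · refine ⟨M, le_trans ?_ (le_max_right _ _)⟩
    rw [setLAverage_eq]
    refine ENNReal.div_le_div (lintegral_mono_set hballK) ?_
    rw [hv, ← Measure.addHaar_ball_center volume a]
    exact measure_mono (Metric.ball_subset_ball (by linarith))

end PshBMO

end

theorem theorem1p6 {n : ℕ} (Ω : Set (EuclideanSpace ℂ (Fin n)))
    (hΩ : PshBMO.IsDomainSet Ω)
    (ψ : EuclideanSpace ℂ (Fin n) → EReal)
    (hψ : PshBMO.IsPlurisubharmonicOn ψ Ω)
    (hne : ∃ z ∈ Ω, ψ z ≠ ⊥) :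
    PshBMO.MemBMOLoc ψ Ω := by
  intro U _ hU
  have hUΩ : U ⊆ Ω := subset_closure.trans hU.2
  exact ⟨ae_restrict_of_ae_restrict_of_subset hUΩ (hψ.ae_finite hΩ hne),
    (hψ.locallyIntegrableOn hΩ hne).mono_set hUΩ, hψ.bmoSeminorm_lt_top hΩ hne hU⟩
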